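/- Let $\mathbb{K}$ be a field. A \emph{non-associative $\mathbb{K}$-algebra} is a $\mathbb{K}$-vector space $A$ with a bilinear multiplication $A\times A\to A$ (not assumed associative, commutative or unital); morphisms are the $\mathbb{K}$-linear maps that preserve the multiplication. Let $\mathbb{K}\{X\}$ be the free non-associative $\mathbb{K}$-algebra on a countably infinite set $X=\{x_1,x_2,\dots\}$ of variables; its elements are called non-associative polynomials. A polynomial $\psi(x_1,\dots,x_n)$ is an \emph{identity} of $A$ if $\psi(a_1,\dots,a_n)=0$ for all $a_1,\dots,a_n\in A$. For a subset $I\subseteq\mathbb{K}\{X\}$, the \emph{variety} $\mathcal{V}$ determined by $I$ is the full subcategory of the category of non-associative $\mathbb{K}$-algebras whose objects are the algebras that satisfy every identity in $I$. \textbf{Theorem.} For every field $\mathbb{K}$ and every subset $I\subseteq\mathbb{K}\{X\}$, the variety $\mathcal{V}$ determined by $I$ is a semi-abelian category. That is: \begin{enumerate} \item (pointed) $\mathcal{V}$ has a zero object; \item (regular) $\mathcal{V}$ has pullbacks, a terminal object and coequalisers, and every pullback of a regular epimorphism (a coequaliser of some parallel pair) is a regular epimorphism; \item (protomodular) the Split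 Short Five Lemma holds in $\mathcal{V}$: given $f\colon A\to B$, $g\colon B\to C$, $s\colon C\to B$, $k\colon D\to E$, $q\colon E\to F$, $t\colon F\to E$ with $f$ a kernel of $g$, $k$ a kernel of $q$, $g s=1_C$, $q t=1_F$, and $\alpha\colon A\to D$, $\beta\colon B\to E$, $\gamma\colon C\to F$ with $\beta f=k\alpha$, $q\beta=\gamma g$ and $\beta s=t\gamma$, if $\alpha$ and $\gamma$ are isomorphisms then so is $\beta$; \item (Barr exact) every internal equivalence relation $p_1,p_2\colon R\rightrightarrows A$ in $\mathcal{V}$ is the kernel pair of some morphism $A\to B$ in $\mathcal{V}$; \item any two objects of $\mathcal{V}$ have a coproduct in $\mathcal{V}$. \end{enumerate} -/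

import Mathlib

open CategoryTheory CategoryTheory.Limits

universe v u

/-- A non-associative algebra over the field `K`: a `K`-vector space with a bilinear
multiplication (distributivity is part of `NonUnitalNonAssocRing`, compatibility with scalars in
the two variables is `IsScalarTower` and `SMulCommClass`). No unit is required. -/
structure NonAssocAlgCat (K : Type u) [Field K] where
  /-- The underlying type. -/
  carrier : Type v
  [isRing : NonUnitalNonAssocRing carrier]
  [isModule : Module K carrier]
  [isScalarTower : IsScalarTower K carrier carrier]
  [smulCommClass : SMulCommClass K carrier carrier]

namespace NonAssocAlgCat

attribute [instance] isRing isModule isScalarTower smulCommClass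

instance (K : Type u) [Field K] : CoeSort (NonAssocAlgCat.{v} K) (Type v) :=
  ⟨carrier⟩

/-- Morphisms of non-associative algebras: `K`-linear maps that preserve the multiplication. -/
@[ext]
structure Hom {K : Type u} [Field K] (A B : NonAssocAlgCat.{v} K) where
  /-- The underlying multiplicative linear map. -/
  hom' : A →ₙₐ[K] B

/-- The category of all non-associative `K`-algebras. -/
instance (K : Type u) [Field K] : Category (NonAssocAlgCat.{v} K) where
  Hom A B := Hom A B
  id A := ⟨NonUnitalAlgHom.id K A⟩
  comp f g := ⟨g.hom'.comp f.hom'⟩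

instance (K : Type u) [Field K] : ConcreteCategory (NonAssocAlgCat.{v} K) (· →ₙₐ[K] ·) where
  hom := Hom.hom'
  ofHom := Hom.mk

/-- The non-associative polynomial `ψ`, in variables indexed by `ℕ`, is an identity of `A`: it
vanishes under every substitution of its variables by elements of `A`. -/
def SatisfiesIdentity {K : Type u} [Field K] (A : NonAssocAlgCat.{v} K)
    (ψ : FreeNonUnitalNonAssocAlgebra K ℕ) : Prop :=
  ∀ a : ℕ → A, FreeNonUnitalNonAssocAlgebra.lift K a ψ = 0

/-- The class of all algebras that satisfy all the identities in the set `I`. -/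
def variety {K : Type u} [Field K] (I : Set (FreeNonUnitalNonAssocAlgebra K ℕ)) :
    ObjectProperty (NonAssocAlgCat.{v} K) :=
  fun A => ∀ ψ ∈ I, A.SatisfiesIdentity ψ

end NonAssocAlgCat

/-- The variety of non-associative `K`-algebras determined by a set `I` of non-associative
polynomials, as a full subcategory of the category of all non-associative `K`-algebras. -/
abbrev NonAssocVariety {K : Type u} [Field K] (I : Set (FreeNonUnitalNonAssocAlgebra K ℕ)) :=
  (NonAssocAlgCat.variety.{v} I).FullSubcategory

/-- Bourn protomodularity of a category with zero morphisms: the Split Short Five Lemma. -/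
def IsProtomodular (C : Type*) [Category* C] [HasZeroMorphisms C] : Prop :=
  ∀ ⦃A B X D E F : C⦄ (f : A ⟶ B) (g : B ⟶ X) (s : X ⟶ B) (k : D ⟶ E) (q : E ⟶ F) (t : F ⟶ E)
    (α : A ⟶ D) (β : B ⟶ E) (γ : X ⟶ F) (hfg : f ≫ g = 0) (hkq : k ≫ q = 0),
    Nonempty (IsLimit (KernelFork.ofι f hfg)) → Nonempty (IsLimit (KernelFork.ofι k hkq)) →
    s ≫ g = 𝟙 X → t ≫ q = 𝟙 F →
    f ≫ β = α ≫ k → β ≫ q = g ≫ γ → s ≫ β = γ ≫ t →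
    IsIso α → IsIso γ → IsIso β

/-- Homological categories: pointed, regular and protomodular. Regularity is understood with
coequalizers of all parallel pairs, not only of kernel pairs. -/
structure IsHomological (C : Type*) [Category* C] : Prop where
  hasZeroObject : HasZeroObject C
  regular : Regular C
  hasCoequalizers : HasCoequalizers C
  protomodular :
    letI : HasZeroMorphisms C := HasZeroObject.zeroMorphismsOfZeroObject
    IsProtomodular C

/-- Every internal equivalence relation is a kernel pair. -/
def EquivalenceRelationsAreKernelPairs (C : Type*) [Category* C] : Prop :=
  ∀ ⦃R X : C⦄ (p₁ p₂ : R ⟶ X), IsEquivalenceRelation p₁ p₂ →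
    ∃ (Y : C) (f : X ⟶ Y), IsKernelPair f p₁ p₂

/-- Semi-abelian categories in the sense of Janelidze, Márki and Tholen: homological categories
that are Barr exact and have binary coproducts. -/
structure IsSemiAbelian (C : Type*) [Category* C] : Prop extends IsHomological C where
  equivalenceRelationsAreKernelPairs : EquivalenceRelationsAreKernelPairs C
  hasBinaryCoproducts : HasBinaryCoproducts C

/-! Identities pass to subalgebras, products and quotients, so the constructions stay in the
variety. Pullbacks are subalgebras of products. The regular epimorphisms are exactly the surjections
(`isRegularEpi_of_surjective`, `surjective_of_isRegularEpi`), and surjections are stable under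
pullback. Coequalisers and coproducts come from one device: quotient an algebra `F` by the common
kernel of a class of homomorphisms from `F` into the variety. Every such homomorphism kills the
values of the identities, so the quotient lies in the variety even when `F` does not.
Protomodularity and exactness rest on subtraction: the five lemma is the usual diagram chase, and a
reflexive relation is congruence modulo its zero class, because `(x, y) - (y, y) = (x - y, 0)`. -/

namespace NonAssocAlgCat

section Algebra

variable {K : Type*} [Field K]

/-! ### Quotients by ideals and descent along surjections. -/

section Quotient

variable {A : Type*} [NonUnitalNonAssocRing A] [Module K A]

/-- A subspace of a non-associative algebra is an ideal if it absorbs multiplication on both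
sides. -/
def IsMulIdeal (N : Submodule K A) : Prop :=
  ∀ a b : A, b ∈ N → a * b ∈ N ∧ b * a ∈ N

/-- The multiplication of the quotient of a non-associative algebra by an ideal. -/
abbrev quotientMul (N : Submodule K A) (hN : IsMulIdeal N) : Mul (A ⧸ N) where
  mul := Quotient.map₂ (· * ·) fun a a' ha b b' hb => by
    have ha := (Submodule.quotientRel_def N).1 ha
    have hb := (Submodule.quotientRel_def N).1 hb
    refine (Submodule.quotientRel_def N).2 ?_
    -- The splitting is `a * b - a' * b' = (a - a') * b + a' * (b - b')`.
    have h := N.add_mem (hN b _ ha).2 (hN a' _ hb).1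
    rwa [sub_mul, mul_sub, sub_add_sub_cancel] at h

/-- The quotient of a non-associative algebra by an ideal, as a non-associative ring. -/
abbrev quotientRing (N : Submodule K A) (hN : IsMulIdeal N) : NonUnitalNonAssocRing (A ⧸ N) :=
  { Submodule.Quotient.addCommGroup N, quotientMul N hN with
    left_distrib := by
      rintro ⟨a⟩ ⟨b⟩ ⟨c⟩
      exact congrArg (Submodule.Quotient.mk (p := N)) (mul_add a b c)
    right_distrib := by
      rintro ⟨a⟩ ⟨b⟩ ⟨c⟩
      exact congrArg (Submodule.Quotient.mk (p := N)) (add_mul a b c)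
    zero_mul := by
      rintro ⟨a⟩
      exact congrArg (Submodule.Quotient.mk (p := N)) (zero_mul a)
    mul_zero := by
      rintro ⟨a⟩
      exact congrArg (Submodule.Quotient.mk (p := N)) (mul_zero a) }

variable [IsScalarTower K A A] [SMulCommClass K A A]

/-- The quotient of a non-associative algebra by an ideal. -/
def quotient (N : Submodule K A) (hN : IsMulIdeal N) : NonAssocAlgCat K :=
  letI := quotientRing N hN
  { carrier := A ⧸ N
    isModule := Submodule.Quotient.module N
    isScalarTower := ⟨by
      rintro r ⟨a⟩ ⟨b⟩
      exact congrArg (Submodule.Quotient.mk (p := N)) (smul_mul_assoc r a b)⟩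
    smulCommClass := ⟨by
      rintro r ⟨a⟩ ⟨b⟩
      exact congrArg (Submodule.Quotient.mk (p := N)) (mul_smul_comm r a b).symm⟩ }

/-- The projection onto the quotient by an ideal. -/
def quotientMk (N : Submodule K A) (hN : IsMulIdeal N) : A →ₙₐ[K] quotient N hN where
  toFun := Submodule.Quotient.mk
  map_smul' _ _ := rfl
  map_zero' := rfl
  map_add' _ _ := rfl
  map_mul' _ _ := rfl

theorem quotientMk_surjective (N : Submodule K A) (hN : IsMulIdeal N) :
    Function.Surjective (quotientMk N hN) :=
  Submodule.Quotient.mk_surjective N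

theorem quotientMk_eq_zero (N : Submodule K A) (hN : IsMulIdeal N) (a : A) :
    quotientMk N hN a = 0 ↔ a ∈ N :=
  Submodule.Quotient.mk_eq_zero N

end Quotient

section Descend

variable {A B C : Type*} [NonUnitalNonAssocRing A] [Module K A]
  [NonUnitalNonAssocRing B] [Module K B] [NonUnitalNonAssocRing C] [Module K C]

/-- The chosen preimage of `b` differs from `a` by an element of the kernel of `p`. This lets the
laws of `descend` be checked on any convenient preimage. -/
theorem apply_surjInv_eq (p : A →ₙₐ[K] B) (hp : Function.Surjective p) (h : A →ₙₐ[K] C)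
    (hk : ∀ a, p a = 0 → h a = 0) (a : A) (b : B) (hab : p a = b) :
    h (Function.surjInv hp b) = h a := by
  rw [← sub_eq_zero, ← map_sub]
  apply hk
  rw [map_sub, Function.surjInv_eq hp, hab, sub_self]

/-- A morphism that vanishes on the kernel of a surjective morphism descends along it. -/
noncomputable def descend (p : A →ₙₐ[K] B) (hp : Function.Surjective p) (h : A →ₙₐ[K] C)
    (hk : ∀ a, p a = 0 → h a = 0) : B →ₙₐ[K] C where
  toFun b := h (Function.surjInv hp b)
  map_smul' r b := by
    rw [apply_surjInv_eq p hp h hk (r • Function.surjInv hp b) _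
      (by rw [map_smul, Function.surjInv_eq hp]), map_smul]
    rfl
  map_zero' := by rw [apply_surjInv_eq p hp h hk 0 _ (map_zero p), map_zero]
  map_add' b c := by
    rw [apply_surjInv_eq p hp h hk (Function.surjInv hp b + Function.surjInv hp c) _
      (by rw [map_add, Function.surjInv_eq hp, Function.surjInv_eq hp]), map_add]
  map_mul' b c := by
    rw [apply_surjInv_eq p hp h hk (Function.surjInv hp b * Function.surjInv hp c) _
      (by rw [map_mul, Function.surjInv_eq hp, Function.surjInv_eq hp]), map_mul]

theorem descend_apply (p : A →ₙₐ[K] B) (hp : Function.Surjective p) (h : A →ₙₐ[K] C)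
    (hk : ∀ a, p a = 0 → h a = 0) (a : A) : descend p hp h hk (p a) = h a :=
  apply_surjInv_eq p hp h hk a _ rfl

end Descend

end Algebra

/-! ### Closure of varieties under subobjects, products and quotients. -/

section Closure

variable {K : Type u} [Field K]

theorem map_lift {X A B : Type*} [NonUnitalNonAssocRing A] [Module K A] [IsScalarTower K A A]
    [SMulCommClass K A A] [NonUnitalNonAssocRing B] [Module K B] [IsScalarTower K B B]
    [SMulCommClass K B B] (h : A →ₙₐ[K] B) (a : X → A) (ψ : FreeNonUnitalNonAssocAlgebra K X) :
    h (FreeNonUnitalNonAssocAlgebra.lift K a ψ) =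
      FreeNonUnitalNonAssocAlgebra.lift K (h ∘ a) ψ := by
  have : h.comp (FreeNonUnitalNonAssocAlgebra.lift K a) =
      FreeNonUnitalNonAssocAlgebra.lift K (h ∘ a) := by
    refine FreeNonUnitalNonAssocAlgebra.hom_ext K fun x => ?_
    rw [NonUnitalAlgHom.comp_apply, FreeNonUnitalNonAssocAlgebra.lift_of_apply,
      FreeNonUnitalNonAssocAlgebra.lift_of_apply, Function.comp_apply]
  exact NonUnitalAlgHom.congr_fun this ψ

variable {I : Set (FreeNonUnitalNonAssocAlgebra K ℕ)}

theorem variety_of_jointly_injective {A B C : NonAssocAlgCat.{v} K} (hB : variety I B)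
    (hC : variety I C) (p : A →ₙₐ[K] B) (q : A →ₙₐ[K] C)
    (h : ∀ a, p a = 0 → q a = 0 → a = 0) : variety I A := fun ψ hψ a =>
  h _ ((map_lift p a ψ).trans (hB ψ hψ _)) ((map_lift q a ψ).trans (hC ψ hψ _))

/-- Every substitution in `B` lifts to `A`. Only the images of the values in `A` must vanish, so `A`
may be a free algebra outside the variety. -/
theorem variety_of_surjective {A : Type*} [NonUnitalNonAssocRing A] [Module K A]
    [IsScalarTower K A A] [SMulCommClass K A A] {B : NonAssocAlgCat.{v} K} (p : A →ₙₐ[K] B)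
    (hp : Function.Surjective p)
    (h : ∀ ψ ∈ I, ∀ a : ℕ → A, p (FreeNonUnitalNonAssocAlgebra.lift K a ψ) = 0) :
    variety I B := fun ψ hψ b => by
  have := h ψ hψ (Function.surjInv hp ∘ b)
  rwa [map_lift, ← Function.comp_assoc, (Function.rightInverse_surjInv hp).comp_eq_id,
    Function.id_comp] at this

end Closure

end NonAssocAlgCat

namespace NonAssocVariety

open NonAssocAlgCat

variable {K : Type u} [Field K] {I : Set (FreeNonUnitalNonAssocAlgebra K ℕ)}

/-! ### Morphisms, zero object and subalgebras. -/

section Morphisms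

variable {X Y Z : NonAssocVariety.{v} I}

/-- The algebra homomorphism underlying a morphism of a variety. -/
def toAlgHom (f : X ⟶ Y) : X.obj →ₙₐ[K] Y.obj := f.hom.hom'

/-- The morphism of a variety given by an algebra homomorphism. -/
def ofAlgHom (f : X.obj →ₙₐ[K] Y.obj) : X ⟶ Y := ⟨⟨f⟩⟩

theorem toAlgHom_comp (f : X ⟶ Y) (g : Y ⟶ Z) (x : X.obj) :
    toAlgHom (f ≫ g) x = toAlgHom g (toAlgHom f x) := rfl

theorem toAlgHom_id (x : X.obj) : toAlgHom (𝟙 X) x = x := rfl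

theorem hom_ext {f g : X ⟶ Y} (h : ∀ x, toAlgHom f x = toAlgHom g x) : f = g :=
  ObjectProperty.hom_ext _ (NonAssocAlgCat.Hom.ext (NonUnitalAlgHom.ext h))

theorem comp_apply_eq {W : NonAssocVariety.{v} I} {f : X ⟶ Y} {g : Y ⟶ Z} {f' : X ⟶ W}
    {g' : W ⟶ Z} (h : f ≫ g = f' ≫ g') (x : X.obj) :
    toAlgHom g (toAlgHom f x) = toAlgHom g' (toAlgHom f' x) := by
  rw [← toAlgHom_comp, h, toAlgHom_comp]

theorem isIso_of_bijective (f : X ⟶ Y) (hf : Function.Bijective (toAlgHom f)) : IsIso f := by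
  refine ⟨ofAlgHom (NonUnitalAlgHom.inverse (toAlgHom f) (Function.surjInv hf.2)
    (Function.leftInverse_surjInv hf) (Function.rightInverse_surjInv hf.2)), ?_, ?_⟩
  · exact hom_ext (Function.leftInverse_surjInv hf)
  · exact hom_ext (Function.rightInverse_surjInv hf.2)

theorem bijective_of_isIso (f : X ⟶ Y) [IsIso f] : Function.Bijective (toAlgHom f) := by
  refine Function.bijective_iff_has_inverse.2 ⟨toAlgHom (inv f), fun x => ?_, fun y => ?_⟩
  · rw [← toAlgHom_comp, IsIso.hom_inv_id, toAlgHom_id]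
  · rw [← toAlgHom_comp, IsIso.inv_hom_id, toAlgHom_id]

end Morphisms

section ZeroObject

variable (I) in
/-- The zero algebra. -/
def zeroAlg : NonAssocVariety.{v} I where
  obj := { carrier := PUnit }
  property _ _ _ := rfl

theorem isZero_zeroAlg : IsZero (zeroAlg.{v} I) where
  unique_to Y := ⟨⟨⟨ofAlgHom 0⟩, fun f => hom_ext fun x => by
    rw [show x = 0 from rfl, map_zero, map_zero]⟩⟩
  unique_from Y := ⟨⟨⟨ofAlgHom 0⟩, fun f => hom_ext fun x => rfl⟩⟩

instance : HasZeroObject (NonAssocVariety.{v} I) := ⟨zeroAlg I, isZero_zeroAlg⟩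

/-- The zero morphisms are an arbitrary structure here; composing one with the zero homomorphism
identifies it. -/
theorem zero_apply [HasZeroMorphisms (NonAssocVariety.{v} I)] {X Y : NonAssocVariety.{v} I}
    (x : X.obj) : toAlgHom (0 : X ⟶ Y) x = 0 := by
  rw [← zero_comp (X := X) (f := (ofAlgHom 0 : X ⟶ Y))]
  rfl

end ZeroObject

section Subalgebras

/-- A subalgebra of an algebra of a variety, as an object of the variety. -/
def sub (X : NonAssocVariety.{v} I) (S : NonUnitalSubalgebra K X.obj) : NonAssocVariety.{v} I where
  obj := { carrier := S }
  property := variety_of_jointly_injective X.property X.property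
    (NonUnitalSubalgebraClass.subtype S) (NonUnitalSubalgebraClass.subtype S)
    fun _ h _ => Subtype.ext h

/-- The inclusion of a subalgebra. -/
def subι (X : NonAssocVariety.{v} I) (S : NonUnitalSubalgebra K X.obj) : sub X S ⟶ X :=
  ofAlgHom (Y := X) (X := sub X S) (NonUnitalSubalgebraClass.subtype S)

theorem subι_injective (X : NonAssocVariety.{v} I) (S : NonUnitalSubalgebra K X.obj) :
    Function.Injective (toAlgHom (subι X S)) := Subtype.val_injective

instance (X : NonAssocVariety.{v} I) (S : NonUnitalSubalgebra K X.obj) : Mono (subι X S) where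
  right_cancellation _ _ h := hom_ext fun x => subι_injective X S (comp_apply_eq h x)

/-- A pair of morphisms is jointly monic only if their kernels intersect trivially. -/
theorem eq_zero_of_jointlyMono {R X Y : NonAssocVariety.{v} I} (p : R ⟶ X) (q : R ⟶ Y)
    [JointlyMono₂ p q] (r : R.obj) (hp : toAlgHom p r = 0) (hq : toAlgHom q r = 0) : r = 0 := by
  -- On the intersection of the two kernels, the inclusion and the zero map become equal after both
  -- `p` and `q`.
  let S : NonUnitalSubalgebra K R.obj :=
    NonUnitalAlgHom.equalizer (toAlgHom p) 0 ⊓ NonUnitalAlgHom.equalizer (toAlgHom q) 0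
  have h : subι R S = ofAlgHom 0 := by
    apply JointlyMono₂.right_cancellation (p₁ := p) (p₂ := q)
    · exact hom_ext fun x => x.2.1.trans (map_zero (toAlgHom p)).symm
    · exact hom_ext fun x => x.2.2.trans (map_zero (toAlgHom q)).symm
  exact congrArg (fun f : sub R S ⟶ R => toAlgHom f ⟨r, hp, hq⟩) h

end Subalgebras

/-! ### Pullbacks and finite limits. -/

section Pullbacks

variable {X Y Z : NonAssocVariety.{v} I} (f : X ⟶ Z) (g : Y ⟶ Z)

/-- The subalgebra of the product that underlies a pullback. -/
def pullbackSubalgebra : NonUnitalSubalgebra K (X.obj × Y.obj) :=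
  NonUnitalAlgHom.equalizer ((toAlgHom f).comp (NonUnitalAlgHom.fst K X.obj Y.obj))
    ((toAlgHom g).comp (NonUnitalAlgHom.snd K X.obj Y.obj))

/-- The pullback of two morphisms of a variety. -/
def pullbackObj : NonAssocVariety.{v} I where
  obj := { carrier := pullbackSubalgebra f g }
  property := variety_of_jointly_injective X.property Y.property
    ((NonUnitalAlgHom.fst K X.obj Y.obj).comp
      (NonUnitalSubalgebraClass.subtype (pullbackSubalgebra f g)))
    ((NonUnitalAlgHom.snd K X.obj Y.obj).comp
      (NonUnitalSubalgebraClass.subtype (pullbackSubalgebra f g)))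
    fun _ h h' => Subtype.ext (Prod.ext h h')

/-- The first projection of a pullback. -/
def pullbackFst : pullbackObj f g ⟶ X :=
  ofAlgHom (X := pullbackObj f g) ((NonUnitalAlgHom.fst K X.obj Y.obj).comp
      (NonUnitalSubalgebraClass.subtype (pullbackSubalgebra f g)))

/-- The second projection of a pullback. -/
def pullbackSnd : pullbackObj f g ⟶ Y :=
  ofAlgHom (X := pullbackObj f g) ((NonUnitalAlgHom.snd K X.obj Y.obj).comp
      (NonUnitalSubalgebraClass.subtype (pullbackSubalgebra f g)))

theorem exists_pullbackObj (x : X.obj) (y : Y.obj) (h : toAlgHom f x = toAlgHom g y) :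
    ∃ a : (pullbackObj f g).obj,
      toAlgHom (pullbackFst f g) a = x ∧ toAlgHom (pullbackSnd f g) a = y :=
  ⟨⟨(x, y), h⟩, rfl, rfl⟩

theorem pullbackObj_ext {a b : (pullbackObj f g).obj}
    (h₁ : toAlgHom (pullbackFst f g) a = toAlgHom (pullbackFst f g) b)
    (h₂ : toAlgHom (pullbackSnd f g) a = toAlgHom (pullbackSnd f g) b) : a = b :=
  Subtype.ext (Prod.ext h₁ h₂)

variable {f g} in
/-- The universal property of the pullback. -/
def pullbackLift {W : NonAssocVariety.{v} I} (p : W ⟶ X) (q : W ⟶ Y) (h : p ≫ f = q ≫ g) :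
    W ⟶ pullbackObj f g :=
  ofAlgHom (Y := pullbackObj f g)
    (NonUnitalAlgHom.codRestrict (NonUnitalAlgHom.prod (toAlgHom p) (toAlgHom q))
      (pullbackSubalgebra f g) fun x => comp_apply_eq h x)

theorem pullback_condition : pullbackFst f g ≫ f = pullbackSnd f g ≫ g :=
  hom_ext fun x => x.2

theorem isPullback_pullbackObj : IsPullback (pullbackFst f g) (pullbackSnd f g) f g :=
  ⟨⟨pullback_condition f g⟩, ⟨PullbackCone.IsLimit.mk _ (fun s => pullbackLift _ _ s.condition)
    (fun _ => rfl) (fun _ => rfl) fun s m h₁ h₂ => hom_ext fun x => by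
      apply pullbackObj_ext
      · exact congrArg (fun k => toAlgHom k x) h₁
      · exact congrArg (fun k => toAlgHom k x) h₂⟩⟩

instance : HasPullbacks (NonAssocVariety.{v} I) :=
  haveI {X Y Z : NonAssocVariety.{v} I} {f : X ⟶ Z} {g : Y ⟶ Z} : HasLimit (cospan f g) :=
    (isPullback_pullbackObj f g).hasPullback
  hasPullbacks_of_hasLimit_cospan _

instance : HasFiniteLimits (NonAssocVariety.{v} I) :=
  haveI : HasTerminal (NonAssocVariety.{v} I) := isZero_zeroAlg.isTerminal.hasTerminal
  hasFiniteLimits_of_hasTerminal_and_pullbacks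

end Pullbacks

/-! ### Regular epimorphisms are surjections. -/

section RegularEpis

variable {X Y : NonAssocVariety.{v} I}

/-- A surjection is the coequaliser of its kernel pair: if `f x = 0`, then `(x, 0)` lies in the
kernel pair, so any `h` coequalising the projections kills `x`. -/
theorem isRegularEpi_of_surjective (f : X ⟶ Y) (hf : Function.Surjective (toAlgHom f)) :
    IsRegularEpi f := by
  have key : ∀ {Z : NonAssocVariety.{v} I} (h : X ⟶ Z),
      pullbackFst f f ≫ h = pullbackSnd f f ≫ h →
      ∀ x, toAlgHom f x = 0 → toAlgHom h x = 0 := by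
    intro Z h hh x hx
    obtain ⟨a, ha₁, ha₂⟩ := exists_pullbackObj f f x 0 (by rw [hx, map_zero])
    have := comp_apply_eq hh a
    rwa [ha₁, ha₂, map_zero] at this
  exact ⟨⟨{
    W := pullbackObj f f
    left := pullbackFst f f
    right := pullbackSnd f f
    w := pullback_condition f f
    isColimit := Cofork.IsColimit.mk _
      (fun s => ofAlgHom (descend (toAlgHom f) hf (toAlgHom s.π) (key s.π s.condition)))
      (fun s => hom_ext fun x => descend_apply _ hf _ (key s.π s.condition) x)
      (fun s m hm => hom_ext fun y => by
        obtain ⟨x, rfl⟩ := hf y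
        exact (congrArg (fun k => toAlgHom k x) hm).trans
          (descend_apply (toAlgHom f) hf (toAlgHom s.π) (key s.π s.condition) x).symm) }⟩⟩

/-- The inclusion of the image is a monomorphism and, as the second factor of a strong epimorphism,
a strong epimorphism; hence it is an isomorphism. -/
theorem surjective_of_isRegularEpi (f : X ⟶ Y) [IsRegularEpi f] :
    Function.Surjective (toAlgHom f) := by
  let S := NonUnitalAlgHom.range (toAlgHom f)
  let e : X ⟶ sub Y S := ofAlgHom (Y := sub Y S)
    (NonUnitalAlgHom.codRestrict (toAlgHom f) S fun x => ⟨x, rfl⟩)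
  have he : StrongEpi (e ≫ subι Y S) := inferInstanceAs (StrongEpi f)
  have := strongEpi_of_strongEpi e (subι Y S)
  have := isIso_of_mono_of_strongEpi (subι Y S)
  intro y
  obtain ⟨⟨z, x, hx⟩, rfl⟩ := (bijective_of_isIso (subι Y S)).2 y
  exact ⟨x, hx⟩

theorem surjective_of_isPullback {P Z : NonAssocVariety.{v} I} {p : P ⟶ X} {q : P ⟶ Y}
    {f : X ⟶ Z} {g : Y ⟶ Z} (h : IsPullback p q f g) (hg : Function.Surjective (toAlgHom g)) :
    Function.Surjective (toAlgHom p) := by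
  intro x
  obtain ⟨y, hy⟩ := hg (toAlgHom f x)
  obtain ⟨a, rfl, -⟩ := exists_pullbackObj f g x y hy.symm
  refine ⟨toAlgHom (h.lift _ _ (pullback_condition f g)) a, ?_⟩
  rw [← toAlgHom_comp, h.lift_fst]

end RegularEpis

/-! ### Universal quotients, coequalisers and coproducts. -/

section Colimits

variable {F : Type*} [NonUnitalNonAssocRing F] [Module K F]
  (P : ∀ Z : NonAssocVariety.{v} I, (F →ₙₐ[K] Z.obj) → Prop)

/-- The common kernel of a class of homomorphisms into the algebras of a variety. -/
def commonKernel : Submodule K F where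
  carrier := {x | ∀ Z h, P Z h → h x = 0}
  add_mem' hx hy Z h hh := by rw [map_add, hx Z h hh, hy Z h hh, add_zero]
  zero_mem' Z h _ := map_zero h
  smul_mem' r x hx Z h hh := by rw [map_smul, hx Z h hh, smul_zero]

theorem isMulIdeal_commonKernel : IsMulIdeal (commonKernel P) := fun a b hb =>
  ⟨fun Z h hh => by rw [map_mul, hb Z h hh, mul_zero],
    fun Z h hh => by rw [map_mul, hb Z h hh, zero_mul]⟩

end Colimits

section UniversalQuotient

variable {F : Type v} [NonUnitalNonAssocRing F] [Module K F] [IsScalarTower K F F]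
  [SMulCommClass K F F] (P : ∀ Z : NonAssocVariety.{v} I, (F →ₙₐ[K] Z.obj) → Prop)

/-- The universal quotient, inside a variety, through which a class of homomorphisms factors. -/
def univQuotient : NonAssocVariety.{v} I where
  obj := quotient (commonKernel P) (isMulIdeal_commonKernel P)
  property := variety_of_surjective _ (quotientMk_surjective _ _) fun ψ hψ a =>
    (quotientMk_eq_zero _ _ _).2 fun Z h _ => (map_lift h a ψ).trans (Z.property ψ hψ _)

/-- The projection onto the universal quotient. -/
def univQuotientMk : F →ₙₐ[K] (univQuotient P).obj :=
  quotientMk (commonKernel P) (isMulIdeal_commonKernel P)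

theorem univQuotientMk_surjective : Function.Surjective (univQuotientMk P) :=
  quotientMk_surjective _ _

variable {P} in
theorem univQuotientMk_eq {x y : F} (hxy : ∀ Z h, P Z h → h x = h y) :
    univQuotientMk P x = univQuotientMk P y := by
  rw [← sub_eq_zero, ← map_sub]
  exact (quotientMk_eq_zero _ _ _).2 fun Z h hh => by rw [map_sub, hxy Z h hh, sub_self]

variable {P} in
/-- The factorization through the universal quotient. -/
noncomputable def univQuotientDesc {Z : NonAssocVariety.{v} I} (h : F →ₙₐ[K] Z.obj)
    (hh : P Z h) : univQuotient P ⟶ Z :=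
  ofAlgHom (X := univQuotient P) (descend (univQuotientMk P) (univQuotientMk_surjective P) h
    fun a ha => (quotientMk_eq_zero _ _ a).1 ha Z h hh)

variable {P} in
theorem univQuotientDesc_mk {Z : NonAssocVariety.{v} I} (h : F →ₙₐ[K] Z.obj) (hh : P Z h)
    (x : F) : toAlgHom (univQuotientDesc h hh) (univQuotientMk P x) = h x :=
  descend_apply _ _ _ (fun a ha =>
    (quotientMk_eq_zero (commonKernel P) (isMulIdeal_commonKernel P) a).1 ha Z h hh) x

variable {P} in
/-- A map that becomes a homomorphism after composition with each member of the class is a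
homomorphism into the universal quotient. -/
def univQuotientLift {X : NonAssocVariety.{v} I} (i : X.obj → F)
    (hi : ∀ Z h, P Z h → ∃ p : X ⟶ Z, ∀ x, h (i x) = toAlgHom p x) : X ⟶ univQuotient P :=
  ofAlgHom {
    toFun x := univQuotientMk P (i x)
    map_smul' r x := by
      refine Eq.trans (univQuotientMk_eq fun Z h hh => ?_) (map_smul _ r _)
      obtain ⟨p, hp⟩ := hi Z h hh
      rw [hp, map_smul, map_smul, hp]
    map_zero' := by
      refine Eq.trans (univQuotientMk_eq fun Z h hh => ?_) (map_zero _)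
      obtain ⟨p, hp⟩ := hi Z h hh
      rw [hp, map_zero, map_zero]
    map_add' x y := by
      refine Eq.trans (univQuotientMk_eq fun Z h hh => ?_) (map_add _ _ _)
      obtain ⟨p, hp⟩ := hi Z h hh
      rw [hp, map_add, map_add, hp, hp]
    map_mul' x y := by
      refine Eq.trans (univQuotientMk_eq fun Z h hh => ?_) (map_mul _ _ _)
      obtain ⟨p, hp⟩ := hi Z h hh
      rw [hp, map_mul, map_mul, hp, hp] }

end UniversalQuotient

section Coequalizers

theorem hasCoequalizer {X Y : NonAssocVariety.{v} I} (f g : X ⟶ Y) : HasCoequalizer f g := by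
  let P : ∀ Z : NonAssocVariety.{v} I, (Y.obj →ₙₐ[K] Z.obj) → Prop :=
    fun Z h => f ≫ ofAlgHom h = g ≫ ofAlgHom h
  let π : Y ⟶ univQuotient P := ofAlgHom (univQuotientMk P)
  have w : f ≫ π = g ≫ π := hom_ext fun x =>
    univQuotientMk_eq fun Z h hh => comp_apply_eq hh x
  exact ⟨⟨{
    cocone := Cofork.ofπ π w
    isColimit := Cofork.IsColimit.mk _
      (fun s => univQuotientDesc (P := P) (toAlgHom s.π) s.condition)
      (fun s => hom_ext fun x => univQuotientDesc_mk (P := P) (toAlgHom s.π) s.condition x)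
      (fun s m hm => hom_ext fun y => by
        obtain ⟨x, rfl⟩ := univQuotientMk_surjective P y
        exact (congrArg (fun k => toAlgHom k x) hm).trans
          (univQuotientDesc_mk (P := P) (toAlgHom s.π) s.condition x).symm) }⟩⟩

instance : HasCoequalizers (NonAssocVariety.{v} I) :=
  haveI {X Y : NonAssocVariety.{v} I} {f g : X ⟶ Y} : HasColimit (parallelPair f g) :=
    hasCoequalizer f g
  hasCoequalizers_of_hasColimit_parallelPair _

instance : Regular (NonAssocVariety.{v} I) where
  hasCoequalizer_of_isKernelPair _ := hasCoequalizer _ _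
  regularEpiIsStableUnderBaseChange := ⟨fun {_ _ _ _ _ g _ g'} h hg =>
    haveI : IsRegularEpi g := hg
    isRegularEpi_of_surjective g' (surjective_of_isPullback h.flip
      (surjective_of_isRegularEpi g))⟩

end Coequalizers

section Coproducts

open FreeNonUnitalNonAssocAlgebra in
-- The free algebra on the disjoint union of the underlying sets is cut down by all homomorphisms
-- induced by pairs `X ⟶ Z`, `Y ⟶ Z`; this makes the insertions of generators homomorphic. The
-- universe `max v u` accommodates the free algebra over `K`.
theorem hasColimit_pair (X Y : NonAssocVariety.{max v u} I) : HasColimit (pair X Y) := by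
  let F := FreeNonUnitalNonAssocAlgebra K (X.obj ⊕ Y.obj)
  let P : ∀ Z : NonAssocVariety.{max v u} I, (F →ₙₐ[K] Z.obj) → Prop := fun Z h =>
    ∃ (p : X ⟶ Z) (q : Y ⟶ Z), h = lift K (Sum.elim (toAlgHom p) (toAlgHom q))
  let inl : X ⟶ univQuotient P := univQuotientLift (P := P) (fun x => of K (Sum.inl x)) (by
    rintro Z _ ⟨p, q, rfl⟩
    exact ⟨p, fun x => lift_of_apply K _ _⟩)
  let inr : Y ⟶ univQuotient P := univQuotientLift (P := P) (fun y => of K (Sum.inr y)) (by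
    rintro Z _ ⟨p, q, rfl⟩
    exact ⟨q, fun x => lift_of_apply K _ _⟩)
  refine ⟨⟨{
    cocone := BinaryCofan.mk inl inr
    isColimit := BinaryCofan.isColimitMk
      (fun s => univQuotientDesc (P := P) _ ⟨s.inl, s.inr, rfl⟩)
      (fun s => hom_ext fun x =>
        (univQuotientDesc_mk (P := P) _ ⟨s.inl, s.inr, rfl⟩ _).trans (lift_of_apply K _ _))
      (fun s => hom_ext fun x =>
        (univQuotientDesc_mk (P := P) _ ⟨s.inl, s.inr, rfl⟩ _).trans (lift_of_apply K _ _))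
      (fun s m h₁ h₂ => hom_ext fun y => ?_) }⟩⟩
  obtain ⟨x, rfl⟩ := univQuotientMk_surjective P y
  refine Eq.trans ?_ (univQuotientDesc_mk (P := P) _ _ _).symm
  refine NonUnitalAlgHom.congr_fun (f := (toAlgHom m).comp (univQuotientMk P)) ?_ x
  refine FreeNonUnitalNonAssocAlgebra.hom_ext K ?_
  rintro (z | z)
  · exact (congrArg (fun k => toAlgHom k z) h₁).trans
      (lift_of_apply K (Sum.elim (toAlgHom s.inl) (toAlgHom s.inr)) (Sum.inl z)).symm
  · exact (congrArg (fun k => toAlgHom k z) h₂).trans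
      (lift_of_apply K (Sum.elim (toAlgHom s.inl) (toAlgHom s.inr)) (Sum.inr z)).symm

theorem hasBinaryCoproducts : HasBinaryCoproducts (NonAssocVariety.{max v u} I) :=
  haveI {X Y : NonAssocVariety.{max v u} I} : HasColimit (pair X Y) := hasColimit_pair X Y
  hasBinaryCoproducts_of_hasColimit_pair _

end Coproducts

/-! ### The Split Short Five Lemma. -/

section Protomodular

variable [HasZeroMorphisms (NonAssocVariety.{v} I)]

/-- The elementwise kernel of `g` is a subalgebra, and its inclusion factors through the categorical
kernel. -/
theorem exists_eq_of_isKernel {A B C : NonAssocVariety.{v} I} {f : A ⟶ B} {g : B ⟶ C}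
    {w : f ≫ g = 0} (h : IsLimit (KernelFork.ofι f w)) (b : B.obj) (hb : toAlgHom g b = 0) :
    ∃ a, toAlgHom f a = b := by
  let S := NonUnitalAlgHom.equalizer (toAlgHom g) 0
  have hS : subι B S ≫ g = 0 := hom_ext fun x => x.2.trans (zero_apply _).symm
  obtain ⟨l, hl⟩ := KernelFork.IsLimit.lift' h _ hS
  exact ⟨toAlgHom l ⟨b, hb⟩, congrArg (fun k : sub B S ⟶ B => toAlgHom k ⟨b, hb⟩) hl⟩

theorem eq_zero_of_isKernel {A B C : NonAssocVariety.{v} I} {f : A ⟶ B} {g : B ⟶ C}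
    {w : f ≫ g = 0} (h : IsLimit (KernelFork.ofι f w)) (a : A.obj) (ha : toAlgHom f a = 0) :
    a = 0 :=
  haveI : JointlyMono₂ f f := ⟨fun _ _ _ hp _ => Fork.IsLimit.hom_ext h hp⟩
  eq_zero_of_jointlyMono f f a ha ha

theorem isProtomodular : IsProtomodular (NonAssocVariety.{v} I) := by
  rintro A B X D E F f g s k q t α β γ hfg hkq ⟨hf⟩ ⟨hk⟩ hs ht hα hβ hγ iα iγ
  have bα := bijective_of_isIso α
  have bγ := bijective_of_isIso γ
  refine isIso_of_bijective β ⟨(injective_iff_map_eq_zero _).2 fun b hb => ?_, fun e => ?_⟩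
  · have hgb : toAlgHom g b = 0 := by
      apply (map_eq_zero_iff _ bγ.1).1
      rw [← comp_apply_eq hβ, hb, map_zero]
    obtain ⟨a, rfl⟩ := exists_eq_of_isKernel hf b hgb
    rw [comp_apply_eq hα] at hb
    rw [(map_eq_zero_iff _ bα.1).1 (eq_zero_of_isKernel hk _ hb), map_zero]
  · obtain ⟨x, hx⟩ := bγ.2 (toAlgHom q e)
    -- Subtracting the lift of `q e` through the splitting moves `e` into the kernel of `q`.
    obtain ⟨d, hd⟩ := exists_eq_of_isKernel hk (e - toAlgHom β (toAlgHom s x)) (by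
      rw [map_sub, comp_apply_eq hγ, ← toAlgHom_comp t q, ht, toAlgHom_id, hx, sub_self])
    obtain ⟨a, rfl⟩ := bα.2 d
    refine ⟨toAlgHom f a + toAlgHom s x, ?_⟩
    rw [map_add, comp_apply_eq hα, hd, sub_add_cancel]

end Protomodular

/-! ### Barr exactness. -/

section Exact

variable {R X : NonAssocVariety.{v} I}

/-- The class of zero of a reflexive relation, as a subspace. -/
def zeroClass (p₁ p₂ : R ⟶ X) : Submodule K X.obj where
  carrier := {x | ∃ r, toAlgHom p₁ r = x ∧ toAlgHom p₂ r = 0}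
  add_mem' := by
    rintro _ _ ⟨r, rfl, hr⟩ ⟨r', rfl, hr'⟩
    exact ⟨r + r', map_add _ _ _, by rw [map_add, hr, hr', add_zero]⟩
  zero_mem' := ⟨0, map_zero _, map_zero _⟩
  smul_mem' := by
    rintro c _ ⟨r, rfl, hr⟩
    exact ⟨c • r, map_smul _ _ _, by rw [map_smul, hr, smul_zero]⟩

/-- Reflexivity gives absorption: `(a, a) * (x, 0) = (a * x, 0)`, and likewise on the right. -/
theorem isMulIdeal_zeroClass {p₁ p₂ : R ⟶ X} (e : ReflexiveRelation p₁ p₂) :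
    IsMulIdeal (zeroClass p₁ p₂) := by
  have h₁ (a) : toAlgHom p₁ (toAlgHom e.r a) = a := by
    rw [← toAlgHom_comp, e.reflexivity₁, toAlgHom_id]
  rintro a _ ⟨r, rfl, hr⟩
  exact ⟨⟨toAlgHom e.r a * r, by rw [map_mul, h₁], by rw [map_mul, hr, mul_zero]⟩,
    ⟨r * toAlgHom e.r a, by rw [map_mul, h₁], by rw [map_mul, hr, zero_mul]⟩⟩

/-- Reflexive relations in a variety of non-associative algebras are kernel pairs. -/
theorem exists_isKernelPair {p₁ p₂ : R ⟶ X} (e : ReflexiveRelation p₁ p₂) :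
    ∃ (Y : NonAssocVariety.{v} I) (f : X ⟶ Y), IsKernelPair f p₁ p₂ := by
  have hN := isMulIdeal_zeroClass e
  let Y : NonAssocVariety.{v} I :=
    ⟨quotient (zeroClass p₁ p₂) hN, variety_of_surjective _ (quotientMk_surjective _ _)
      fun ψ hψ a => by rw [X.property ψ hψ a, map_zero]⟩
  let f : X ⟶ Y := ofAlgHom (Y := Y) (quotientMk (zeroClass p₁ p₂) hN)
  have hf (x : X.obj) : toAlgHom f x = 0 ↔ ∃ r, toAlgHom p₁ r = x ∧ toAlgHom p₂ r = 0 :=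
    quotientMk_eq_zero _ hN x
  have hr₁ (a) : toAlgHom p₁ (toAlgHom e.r a) = a := by
    rw [← toAlgHom_comp, e.reflexivity₁, toAlgHom_id]
  have hr₂ (a) : toAlgHom p₂ (toAlgHom e.r a) = a := by
    rw [← toAlgHom_comp, e.reflexivity₂, toAlgHom_id]
  have w : p₁ ≫ f = p₂ ≫ f := hom_ext fun r => by
    rw [toAlgHom_comp, toAlgHom_comp, ← sub_eq_zero, ← map_sub, hf]
    -- This is `(x, y) - (y, y) = (x - y, 0)`.
    exact ⟨r - toAlgHom e.r (toAlgHom p₂ r), by rw [map_sub, hr₁], by rw [map_sub, hr₂, sub_self]⟩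
  have h₁ (r : R.obj) : toAlgHom (pullbackFst f f) (toAlgHom (pullbackLift p₁ p₂ w) r) =
    toAlgHom p₁ r := rfl
  have h₂ (r : R.obj) : toAlgHom (pullbackSnd f f) (toAlgHom (pullbackLift p₁ p₂ w) r) =
    toAlgHom p₂ r := rfl
  have : IsIso (pullbackLift p₁ p₂ w) := by
    refine isIso_of_bijective _ ⟨(injective_iff_map_eq_zero _).2 fun r hr => ?_, fun a => ?_⟩
    · have := e.toJointlyMono₂
      apply eq_zero_of_jointlyMono p₁ p₂ r
      · rw [← h₁, hr, map_zero]
      · rw [← h₂, hr, map_zero]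
    · obtain ⟨r, hr, hr'⟩ := (hf (toAlgHom (pullbackFst f f) a - toAlgHom (pullbackSnd f f) a)).1
        (by rw [map_sub, comp_apply_eq (pullback_condition f f), sub_self])
      -- Conversely, `(x - y, 0) + (y, y) = (x, y)`; symmetry and transitivity play no part.
      refine ⟨r + toAlgHom e.r (toAlgHom (pullbackSnd f f) a), pullbackObj_ext f f ?_ ?_⟩
      · rw [h₁, map_add, hr, hr₁, sub_add_cancel]
      · rw [h₂, map_add, hr', hr₂, zero_add]
  exact ⟨Y, f, (isPullback_pullbackObj f f).of_iso (asIso (pullbackLift p₁ p₂ w)).symm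
    (Iso.refl _) (Iso.refl _) (Iso.refl _)
    (by rw [Iso.symm_hom, asIso_inv, IsIso.eq_inv_comp, Iso.refl_hom, Category.comp_id]; rfl)
    (by rw [Iso.symm_hom, asIso_inv, IsIso.eq_inv_comp, Iso.refl_hom, Category.comp_id]; rfl)
    (by simp) (by simp)⟩

end Exact

end NonAssocVariety

theorem mainTheorem1 {K : Type u} [Field K] (I : Set (FreeNonUnitalNonAssocAlgebra K ℕ)) :
    IsSemiAbelian (NonAssocVariety.{max v u} I) where
  hasZeroObject := inferInstance
  regular := inferInstance
  hasCoequalizers := inferInstance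
  protomodular :=
    letI : HasZeroMorphisms (NonAssocVariety.{max v u} I) :=
      HasZeroObject.zeroMorphismsOfZeroObject
    NonAssocVariety.isProtomodular
  equivalenceRelationsAreKernelPairs _ _ _ _ h :=
    NonAssocVariety.exists_isKernelPair h.nonempty_equivalenceRelation.some.toReflexiveRelation
  hasBinaryCoproducts := NonAssocVariety.hasBinaryCoproducts
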